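/- **Setting.** Let $P\subseteq\mathbb R^n$ be a polyhedron defined by finitely many hyperplanes, $P_I=\{x\in P: x_j\in\mathbb Z\ \forall j\in I\}$, and let $\bar x$ be a basic feasible solution of $P$. Let $\bar C$ be the simple cone with apex $\bar x$ defined by $n$ hyperplanes of $P$ with linearly independent normals that are tight at $\bar x$, and let $r^1,\dots,r^n$ (the set $\bar{\mathcal R}$) be its extreme rays. Let $S$ be a closed convex set with $\bar x\in\operatorname{int}S$ and $\operatorname{int}S\cap P_I=\emptyset$. For a hyperplane $H=\{x:a^{\mathsf T}x=b\}$ put $H^+=\{x:a^{\mathsf T}x\ge b\}$, let $\operatorname{dist}(H,r)=(b-a^{\mathsf T}\bar x)/a^{\mathsf T}r$ if $a^{\mathsf T}r<0$ and $\infty$ otherwise, let $\operatorname{dist}(\operatorname{bd}S,r)$ be the distance from $\bar x$ along $r$ to $\operatorname{bd}S$ ($\infty$ if it is not met), and let $\mathcal R(H)=\{r\in\bar{\mathcal R}:\operatorname{dist}(H,r)<\operatorname{dist}(\operatorname{bd}S,r)\}$. A point-ray collection $(\mathcal P,\mathcal R)$ comes with the edges that led to its elements: an edge gives its intersection point with $\operatorname{bd}S$,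 or its direction if it does not meet $\operatorname{bd}S$; an element originates from $r^j$ if its edge starts on $r^j$. The collection is *proper* if every inequality $\alpha^{\mathsf T}x\ge\beta$ with $\alpha^{\mathsf T}p\ge\beta$ $(p\in\mathcal P)$, $\alpha^{\mathsf T}r\ge0$ $(r\in\mathcal R)$ and $\alpha^{\mathsf T}\bar x<\beta$ is valid for $P_I$. The initial collection is given by the $n$ rays of $\bar C$ themselves. **PHA1$(P,S,H,\mathcal R_A,(\mathcal P,\mathcal R))$**: for each $r\in\mathcal R_A\cap\mathcal R(H)$, (i) remove all points outside $H^+$ and all rays $d$ with $a^{\mathsf T}d<0$ that originate from $r$ and do not lie on or coincide with a ray of $\bar{\mathcal R}\setminus\mathcal R_A$; (ii) for each $r'\in\bar{\mathcal R}\setminus\{r\}$ consider the edge that starts at $r\cap H$ and runs along $H$ in the two-dimensional face of $\bar C$ spanned by $r,r'$ (with direction $r'-\frac{a^{\mathsf T}r'}{a^{\mathsf T}r}\,r$), and, unless it meets a hyperplane of $\bar C$ not containing $r$ strictly before $\operatorname{bd}S$, add its intersection point with $\operatorname{bd}S$, or its direction if there is none. **Targeted tilting.** For $\mathcal R'\subseteq\mathcal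 R(H)$, a targeted tilting of $H$ is a hyperplane $\tilde H$, with $\bar x\in\tilde H^+$, that goes through the point $r\cap\operatorname{bd}S$ (or is parallel to $r$, if there is no such point) for all $r\in\mathcal R(H)\setminus\mathcal R'$, and through the intersection point of $H$ with the line of $r$ (or is parallel to $r$, if $H$ is) for every other $r\in\bar{\mathcal R}$. **Theorem.** Let $H$ be a hyperplane with $P\subseteq H^+$ (for instance one that defines $P$) and $\bar x\notin H$. Let $(\mathcal P,\mathcal R)$ be a proper point-ray collection obtained from the initial one by finitely many PHA1 calls (each with an arbitrary set of permitted rays and a hyperplane that is valid for $P$ and not tight at $\bar x$), and let $\mathcal R^c\subseteq\bar{\mathcal R}$ be the set of rays cut in these calls, i.e. of all $r\in\mathcal R_A\cap\mathcal R(H')$ over the calls with hyperplane $H'$ and permitted rays $\mathcal R_A$. Let $\mathcal R'\subseteq\mathcal R(H)$ with $\mathcal R^c\cap\mathcal R(H)\subseteq\mathcal R'$. Then: 1. the point-ray collection returned by PHA1$(P,S,H,\mathcal R',(\mathcal P,\mathcal R))$ is proper; 2. if $\mathcal R'\neq\emptyset$, a targeted tilting of $H$ with respect to $\mathcal R'$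 exists and is unique as a hyperplane; 3. for every targeted tilting $\tilde H$ of $H$ with respect to $\mathcal R'$, PHA1$(P,S,H,\mathcal R',(\mathcal P,\mathcal R))$ and PHA1$(P,S,\tilde H,\bar{\mathcal R},(\mathcal P,\mathcal R))$ return the same set of points and the same set of rays. -/

import Mathlib

open scoped Matrix

namespace GIC

/-- A hyperplane `{x | aᵀx = b}`, `a ≠ 0`, together with the choice of its halfspace
`{x | aᵀx ≥ b}`. -/
structure Hyperplane (n : ℕ) where
  a : Fin n → ℝ
  b : ℝ
  a_ne_zero : a ≠ 0

namespace Hyperplane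

variable {n : ℕ}

/-- The points of the hyperplane `H`. -/
def carrier (H : Hyperplane n) : Set (Fin n → ℝ) := {x | H.a ⬝ᵥ x = H.b}

/-- The closed halfspace `H⁺`. -/
def pos (H : Hyperplane n) : Set (Fin n → ℝ) := {x | H.b ≤ H.a ⬝ᵥ x}

end Hyperplane

/-- A mixed integer set given by finitely many halfspaces and a set `I` of integer coordinates,
a basic feasible solution `xbar` of its linear relaxation `P`, the rays of the simple cone of the
chosen basis, and a closed convex set `S` that contains `xbar` in its interior and contains no
point of `P_I` in its interior. -/
structure Data (n : ℕ) where
  /-- the number of hyperplanes defining `P` -/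
  m : ℕ
  /-- the hyperplanes defining `P` -/
  hyp : Fin m → Hyperplane n
  /-- the integer-constrained coordinates -/
  I : Set (Fin n)
  /-- the vertex -/
  xbar : Fin n → ℝ
  xbar_mem : ∀ i, xbar ∈ (hyp i).pos
  /-- the indices of the `n` hyperplanes that define the simple cone at `xbar` -/
  cobasis : Fin n → Fin m
  xbar_tight : ∀ j, xbar ∈ (hyp (cobasis j)).carrier
  /-- `ray j` is a direction vector of the extreme ray of the cone that lies on all of its `n`
  hyperplanes except the `j`-th. (The sign conditions force the `n` normals to be linearly
  independent and determine `ray j` up to a positive factor.) -/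
  ray : Fin n → Fin n → ℝ
  ray_facet : ∀ i j, i ≠ j → (hyp (cobasis i)).a ⬝ᵥ ray j = 0
  ray_pos : ∀ j, 0 < (hyp (cobasis j)).a ⬝ᵥ ray j
  /-- the cut-generating set -/
  S : Set (Fin n → ℝ)
  S_closed : IsClosed S
  S_convex : Convex ℝ S
  xbar_mem_interior : xbar ∈ interior S
  S_free : ∀ x, (∀ i, x ∈ (hyp i).pos) → (∀ j ∈ I, ∃ z : ℤ, x j = z) → x ∉ interior S

/-- A point of the space, or the direction of a ray. -/
inductive PointOrRay (n : ℕ) where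
  | point (x : Fin n → ℝ)
  | ray (d : Fin n → ℝ)

/-- An edge is recorded by its starting vertex and its direction. -/
structure Edge (n : ℕ) where
  start : Fin n → ℝ
  dir : Fin n → ℝ

namespace PointOrRay

variable {n : ℕ}

/-- A point lies on `H`; a ray is parallel to `H`. -/
def On (H : Hyperplane n) : PointOrRay n → Prop
  | point x => H.a ⬝ᵥ x = H.b
  | ray d => H.a ⬝ᵥ d = 0

/-- A point lies outside `H⁺`; a ray is not a recession direction of `H⁺`. -/
def Violates (H : Hyperplane n) : PointOrRay n → Prop
  | point x => H.a ⬝ᵥ x < H.b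
  | ray d => H.a ⬝ᵥ d < 0

end PointOrRay

namespace Data

variable {n : ℕ} (T : Data n)

/-- The polyhedron `P`. -/
def P : Set (Fin n → ℝ) := {x | ∀ i, x ∈ (T.hyp i).pos}

/-- The mixed integer set `P_I`. -/
def PI : Set (Fin n → ℝ) := {x | x ∈ T.P ∧ ∀ j ∈ T.I, ∃ z : ℤ, x j = z}

/-- The distance along the half-line from `v` in direction `d` to the boundary of `S`
(`⊤` if the half-line does not meet the boundary), in multiples of `d`. -/
noncomputable def distBd (v d : Fin n → ℝ) : EReal :=
  sInf {τ : EReal | ∃ t : ℝ, 0 ≤ t ∧ v + t • d ∈ frontier T.S ∧ τ = (t : EReal)}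

open Classical in
/-- The distance along ray `j` from `xbar` to `H` (`⊤` if the ray does not leave `H⁺`). -/
noncomputable def distHyp (H : Hyperplane n) (j : Fin n) : EReal :=
  if H.a ⬝ᵥ T.ray j < 0 then (((H.b - H.a ⬝ᵥ T.xbar) / (H.a ⬝ᵥ T.ray j) : ℝ) : EReal) else ⊤

/-- The rays of the cone that are intersected by `H` before the boundary of `S`. -/
def cutRays (H : Hyperplane n) : Set (Fin n) :=
  {j | T.distHyp H j < T.distBd T.xbar (T.ray j)}

open Classical in
/-- What the half-line from `v` in direction `d` contributes: its intersection point with the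
boundary of `S`, or its direction if it does not meet the boundary. -/
noncomputable def exit (v d : Fin n → ℝ) : PointOrRay n :=
  if T.distBd v d = ⊤ then .ray d else .point (v + (T.distBd v d).toReal • d)

/-- The point or ray to which the edge `e` leads. -/
noncomputable def element (e : Edge n) : PointOrRay n := T.exit e.start e.dir

/-- The intersection points of a collection that is recorded by its edges. -/
def points (D : Set (Edge n)) : Set (Fin n → ℝ) := {p | ∃ e ∈ D, T.element e = .point p}

/-- The rays of a collection that is recorded by its edges. -/
def rays (D : Set (Edge n)) : Set (Fin n → ℝ) := {d | ∃ e ∈ D, T.element e = .ray d}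

/-- The point-ray collection is proper: each inequality `αᵀx ≥ β` satisfied by its points and
(homogeneously) by its rays, and violated by `xbar`, is valid for `P_I`. -/
def Proper (Pts Rys : Set (Fin n → ℝ)) : Prop :=
  ∀ (α : Fin n → ℝ) (β : ℝ), (∀ p ∈ Pts, β ≤ α ⬝ᵥ p) → (∀ d ∈ Rys, 0 ≤ α ⬝ᵥ d) →
    α ⬝ᵥ T.xbar < β → ∀ x ∈ T.PI, β ≤ α ⬝ᵥ x

/-- The edge `e` starts at a vertex on ray `j`. -/
def OriginatesFrom (e : Edge n) (j : Fin n) : Prop :=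
  ∃ t : ℝ, 0 ≤ t ∧ e.start = T.xbar + t • T.ray j

/-- A point lies on ray `k` of the cone; a ray has the direction of ray `k`. -/
def LiesOnRay (k : Fin n) : PointOrRay n → Prop
  | .point x => ∃ t : ℝ, 0 ≤ t ∧ x = T.xbar + t • T.ray k
  | .ray d => ∃ t : ℝ, 0 < t ∧ d = t • T.ray k

/-- The intersection of ray `j`, or of its opposite ray, with `H`; the ray itself if it is parallel
to `H`. -/
noncomputable def vHyp (H : Hyperplane n) (j : Fin n) : PointOrRay n :=
  open Classical in
  if H.a ⬝ᵥ T.ray j = 0 then .ray (T.ray j)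
  else .point (T.xbar + ((H.b - H.a ⬝ᵥ T.xbar) / (H.a ⬝ᵥ T.ray j)) • T.ray j)

/-- The intersection of ray `j` with the boundary of `S`; the ray itself if there is none. -/
noncomputable def vBd (j : Fin n) : PointOrRay n := T.exit T.xbar (T.ray j)

/-- The vertex at which ray `j` meets `H` (used when `aᵀ(ray j) < 0`). -/
noncomputable def vertex (H : Hyperplane n) (j : Fin n) : Fin n → ℝ :=
  T.xbar + ((H.b - H.a ⬝ᵥ T.xbar) / (H.a ⬝ᵥ T.ray j)) • T.ray j

/-- The new edge that emanates from the vertex of ray `j` and `H` inside the two-dimensional face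
of the cone spanned by the rays `j` and `k`: its direction is the combination of the two rays
with coefficient one at ray `k` that is parallel to `H`. -/
noncomputable def newEdge (H : Hyperplane n) (j k : Fin n) : Edge n where
  start := T.vertex H j
  dir := T.ray k - ((H.a ⬝ᵥ T.ray k) / (H.a ⬝ᵥ T.ray j)) • T.ray j

/-- The edge `e` meets, before it reaches the boundary of `S`, a hyperplane of the cone that does
not contain ray `j`. -/
def HitsCone (e : Edge n) (j : Fin n) : Prop :=
  ∃ i : Fin n, (T.hyp (T.cobasis i)).a ⬝ᵥ T.ray j ≠ 0 ∧
    ∃ t : ℝ, 0 ≤ t ∧ (t : EReal) < T.distBd e.start e.dir ∧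
      e.start + t • e.dir ∈ (T.hyp (T.cobasis i)).carrier

/-- One pass of the main loop of the algorithm, for ray `j`. -/
def activateRay (H : Hyperplane n) (RA : Set (Fin n)) (j : Fin n) (D : Set (Edge n)) :
    Set (Edge n) :=
  {e | e ∈ D ∧ ¬ ((T.element e).Violates H ∧ T.OriginatesFrom e j ∧
      ¬ ∃ k, k ∉ RA ∧ T.LiesOnRay k (T.element e))} ∪
  {e | ∃ k, k ≠ j ∧ e = T.newEdge H j k ∧ ¬ T.HitsCone e j}

open Classical in
/-- Distance 1 partial hyperplane activation of `H` with permitted rays `RA`, applied to the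
collection recorded by `D`. -/
noncomputable def PHA1 (H : Hyperplane n) (RA : Set (Fin n)) (D : Set (Edge n)) : Set (Edge n) :=
  (List.finRange n).foldl
    (fun D j => if j ∈ RA ∧ j ∈ T.cutRays H then T.activateRay H RA j D else D) D

/-- The `n` edges of the cone itself. -/
def initialEdges : Set (Edge n) := {e | ∃ j, e = ⟨T.xbar, T.ray j⟩}

/-- `T.Run D Rc`: the collection recorded by `D` is obtained from the initial one by finitely many
calls of the algorithm, with hyperplanes that are valid for `P` and not tight at `xbar`, and `Rc`
is the set of rays of the cone that have been cut in these calls. -/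
inductive Run : Set (Edge n) → Set (Fin n) → Prop
  | init : Run T.initialEdges ∅
  | step {D : Set (Edge n)} {Rc : Set (Fin n)} (H : Hyperplane n) (RA : Set (Fin n)) :
      Run D Rc → T.P ⊆ H.pos → T.xbar ∉ H.carrier →
      Run (T.PHA1 H RA D) (Rc ∪ (RA ∩ T.cutRays H))

/-- `Ht` is the targeted tilting of `H` with respect to `R'`, with `xbar` on its positive side. -/
structure IsTargetedTilting (H : Hyperplane n) (R' : Set (Fin n)) (Ht : Hyperplane n) : Prop where
  xbar_mem : T.xbar ∈ Ht.pos
  tilted : ∀ j ∈ T.cutRays H \ R', (T.vBd j).On Ht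
  kept : ∀ j ∉ T.cutRays H \ R', (T.vHyp H j).On Ht

end Data

end GIC

/-! Everything is centred at `xbar` and homogenized: a point x becomes the vector x − xbar of height
1, a ray its direction with height 0. Inequalities violated by `xbar` become forms α with α·vec ≥
height, and a halfspace with `xbar` strictly inside becomes gauge ≤ 1. A form that is at most 1 on S
(`Bounds`) is at most the height on every exit from S, and some such form attains equality there.

Properness: let α be feasible for the new collection and x ∈ P_I. Since x is not interior to S, some
bounding form σ has value 1 at x, so it suffices that δ = α − σ is nonnegative at x. On the new
collection δ ≥ 0. If δ is negative on a ray of R', the worst ratio over R' yields μ > 0 with δ ≥ μ(σ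
− gauge) on all rays of the cone, hence on P, and at x the right side is μ(1 − gauge) ≥ 0. Otherwise
δ ≥ 0 on the removed elements too (`nonneg_of_nonneg_newEdge`), and properness of the old collection
applies in the homogeneous form `nonneg_of_proper`.

Tilting: a gauge is determined by its values on the n independent rays, which gives existence and
uniqueness. The tilted hyperplane cuts exactly R' and removes the same edges as H. Its only
different new edges run towards spared rays, the rays of R(H) outside R'; they lead to the exits of
those rays, which are already present because these rays were never cut and are protected from
removal. -/

namespace GIC

namespace PointOrRay

variable {n : ℕ}

/-- The displacement of a point from `c`, or the direction of a ray. -/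
def vec (c : Fin n → ℝ) : PointOrRay n → (Fin n → ℝ)
  | point x => x - c
  | ray d => d

/-- The homogenizing coordinate: `1` for points and `0` for rays. -/
def height : PointOrRay n → ℝ
  | point _ => 1
  | ray _ => 0

theorem height_le_one (q : PointOrRay n) : q.height ≤ 1 := by
  cases q <;> simp [height]

end PointOrRay

/-! ### Half-lines from the interior of S and their exits -/

namespace Data

variable {n : ℕ} (T : Data n)

theorem add_smul_mem_interior_of_le {v d : Fin n → ℝ} (hv : v ∈ interior T.S) {s t : ℝ}
    (hs : 0 ≤ s) (hst : s < t) (h : v + t • d ∈ T.S) : v + s • d ∈ interior T.S := by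
  have ht : 0 < t := lt_of_le_of_lt hs hst
  have := T.S_convex.combo_interior_self_mem_interior hv h (a := 1 - s / t) (b := s / t)
    (by rw [sub_pos, div_lt_one ht]; exact hst) (by positivity) (by ring)
  convert this using 1
  rw [smul_add, smul_smul, div_mul_cancel₀ _ ht.ne', ← add_assoc, ← add_smul]
  simp

/-- A connected segment that starts in the interior and misses the frontier stays in the interior.
Conversely, openness extends an interior segment slightly, and by convexity no frontier point
precedes its end. -/
theorem lt_distBd_iff {v d : Fin n → ℝ} (hv : v ∈ interior T.S) {t : ℝ} (ht : 0 ≤ t) :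
    (t : EReal) < T.distBd v d ↔ v + t • d ∈ interior T.S := by
  have hc : Continuous fun s : ℝ => v + s • d := by fun_prop
  constructor
  · intro h
    have hno : ∀ s : ℝ, 0 ≤ s → s ≤ t → v + s • d ∉ frontier T.S := by
      intro s hs hst hf
      have : T.distBd v d ≤ (s : EReal) := sInf_le ⟨s, hs, hf, rfl⟩
      exact absurd (h.trans_le this) (not_lt.mpr (EReal.coe_le_coe_iff.mpr hst))
    have hpre : IsPreconnected ((fun s : ℝ => v + s • d) '' Set.Icc 0 t) :=
      isPreconnected_Icc.image _ hc.continuousOn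
    have hne : ((fun s : ℝ => v + s • d) '' Set.Icc 0 t ∩ interior T.S).Nonempty :=
      ⟨v, ⟨0, ⟨le_rfl, ht⟩, by simp⟩, hv⟩
    have hsub := hpre.subset_left_of_subset_union isOpen_interior
      (isClosed_closure (s := T.S)).isOpen_compl
      (Set.disjoint_left.mpr fun x hx hx' => hx' (subset_closure (interior_subset hx)))
      (by
        rintro _ ⟨s, hs, rfl⟩
        by_contra hx
        simp only [Set.mem_union, not_or, Set.mem_compl_iff, not_not] at hx
        exact hno s hs.1 hs.2 ⟨hx.2, hx.1⟩) hne
    exact hsub (Set.mem_image_of_mem _ (Set.right_mem_Icc.mpr ht))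
  · intro h
    have hopen : IsOpen ((fun s : ℝ => v + s • d) ⁻¹' interior T.S) :=
      isOpen_interior.preimage hc
    obtain ⟨ε, hε, hball⟩ := Metric.isOpen_iff.mp hopen t h
    have hmem : v + (t + ε / 2) • d ∈ interior T.S :=
      hball (by rw [Metric.mem_ball, Real.dist_eq]; rw [abs_lt]; constructor <;> linarith)
    refine lt_of_lt_of_le (EReal.coe_lt_coe_iff.mpr (by linarith : t < t + ε / 2)) ?_
    refine le_sInf ?_
    rintro _ ⟨s, hs, hf, rfl⟩
    rw [EReal.coe_le_coe_iff]
    by_contra hlt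
    rw [not_le] at hlt
    exact hf.2 (T.add_smul_mem_interior_of_le hv hs hlt (interior_subset hmem))

theorem distBd_eq_coe {v d : Fin n → ℝ} (hv : v ∈ interior T.S) {t : ℝ} (ht : 0 ≤ t)
    (h : v + t • d ∈ frontier T.S) : T.distBd v d = t := by
  refine le_antisymm (sInf_le ⟨t, ht, h, rfl⟩) (le_sInf ?_)
  rintro _ ⟨s, hs, hf, rfl⟩
  rw [EReal.coe_le_coe_iff]
  by_contra hlt
  rw [not_le] at hlt
  exact hf.2 (T.add_smul_mem_interior_of_le hv hs hlt (T.S_closed.frontier_subset h))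

theorem exit_eq_point {v d : Fin n → ℝ} (hv : v ∈ interior T.S) {t : ℝ} (ht : 0 ≤ t)
    (h : v + t • d ∈ frontier T.S) : T.exit v d = .point (v + t • d) := by
  simp [exit, T.distBd_eq_coe hv ht h]

theorem exit_eq_ray {v d : Fin n → ℝ}
    (h : ∀ t : ℝ, 0 ≤ t → v + t • d ∈ interior T.S) : T.exit v d = .ray d := by
  have : T.distBd v d = ⊤ := by
    refine sInf_eq_top.mpr ?_
    rintro _ ⟨s, hs, hf, rfl⟩
    exact absurd (h s hs) hf.2
  simp [exit, this]

theorem exit_cases {v : Fin n → ℝ} (d : Fin n → ℝ) (hv : v ∈ interior T.S) :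
    (T.exit v d = .ray d ∧ ∀ t : ℝ, 0 ≤ t → v + t • d ∈ interior T.S) ∨
    ∃ t : ℝ, 0 < t ∧ T.exit v d = .point (v + t • d) ∧ v + t • d ∈ frontier T.S ∧
      ∀ s : ℝ, 0 ≤ s → s < t → v + s • d ∈ interior T.S := by
  by_cases hne : ∃ t : ℝ, 0 ≤ t ∧ v + t • d ∉ interior T.S
  · right
    obtain ⟨t, ht, hout⟩ := hne
    rw [← T.lt_distBd_iff hv ht, not_lt] at hout
    have h0 : ((0 : ℝ) : EReal) < T.distBd v d := (T.lt_distBd_iff hv le_rfl).mpr (by simpa using hv)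
    obtain ⟨τ, hτ⟩ : ∃ τ : ℝ, T.distBd v d = τ :=
      ⟨_, (EReal.coe_toReal (ne_top_of_le_ne_top (EReal.coe_ne_top t) hout)
        (ne_bot_of_gt h0)).symm⟩
    rw [hτ, EReal.coe_lt_coe_iff] at h0
    have hint : ∀ s : ℝ, 0 ≤ s → s < τ → v + s • d ∈ interior T.S := fun s hs hlt =>
      (T.lt_distBd_iff hv hs).mp (by rw [hτ]; exact EReal.coe_lt_coe_iff.mpr hlt)
    refine ⟨τ, h0, ?_, ⟨?_, ?_⟩, hint⟩
    · simp [exit, hτ]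
    · have hc : ContinuousWithinAt (fun s : ℝ => v + s • d) (Set.Ioo 0 τ) τ := by fun_prop
      refine hc.mem_closure ?_ fun s hs => interior_subset (hint s hs.1.le hs.2)
      rw [closure_Ioo h0.ne]
      exact ⟨h0.le, le_rfl⟩
    · intro h
      have := (T.lt_distBd_iff hv h0.le).mpr h
      rw [hτ] at this
      exact lt_irrefl _ this
  · left
    push Not at hne
    exact ⟨T.exit_eq_ray hne, hne⟩

/-! ### Linear forms bounding S -/

/-- The linear form `φ`, centred at `xbar`, is at most `1` on `S`, strictly so in the interior. -/
structure Bounds (φ : Fin n → ℝ) : Prop where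
  le : ∀ y ∈ T.S, φ ⬝ᵥ (y - T.xbar) ≤ 1
  lt : ∀ y ∈ interior T.S, φ ⬝ᵥ (y - T.xbar) < 1

theorem bounds_zero : T.Bounds 0 := ⟨by simp, by simp⟩

/-- Hahn–Banach separates x from the open set int S; the functional is scaled by its positive
increment from `xbar` to x. -/
theorem exists_bounds_eq_one {x : Fin n → ℝ} (hx : x ∉ interior T.S) :
    ∃ φ, T.Bounds φ ∧ φ ⬝ᵥ (x - T.xbar) = 1 := by
  obtain ⟨f, hf⟩ := geometric_hahn_banach_open_point T.S_convex.interior isOpen_interior hx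
  have hrep : ∀ v, f v = (fun i => f (Pi.single i 1)) ⬝ᵥ v := by
    intro v
    have := LinearMap.pi_apply_eq_sum_univ (f : (Fin n → ℝ) →ₗ[ℝ] ℝ) v
    simp only [ContinuousLinearMap.coe_coe, smul_eq_mul] at this
    rw [this, dotProduct]
    refine Finset.sum_congr rfl fun i _ => ?_
    rw [mul_comm]
    congr 2
    ext j
    simp [Pi.single_apply, eq_comm]
  set c := f x - f T.xbar with hc
  have hcpos : 0 < c := sub_pos.mpr (hf _ T.xbar_mem_interior)
  refine ⟨c⁻¹ • fun i => f (Pi.single i 1), ⟨fun y hy => ?_, fun y hy => ?_⟩, ?_⟩ <;>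
    rw [smul_dotProduct, ← hrep, map_sub, smul_eq_mul, inv_mul_eq_div]
  -- Separation bounds f on the interior only; the weak bound passes to S, which lies in the closure
  -- of its nonempty interior.
  · have hle : f y ≤ f x := by
      have hy' : y ∈ closure (interior T.S) := by
        rw [T.S_convex.closure_interior_eq_closure_of_nonempty_interior ⟨_, T.xbar_mem_interior⟩]
        exact subset_closure hy
      exact closure_minimal (fun z hz => (hf z hz).le)
        (isClosed_le f.continuous continuous_const) hy'
    rw [div_le_one hcpos]
    linarith
  · rw [div_lt_one hcpos]
    have := hf y hy
    linarith
  · exact div_self hcpos.ne'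

variable {T}

theorem Bounds.dotProduct_nonpos {φ : Fin n → ℝ} (hφ : T.Bounds φ) {v d : Fin n → ℝ}
    (h : ∀ t : ℝ, 0 ≤ t → v + t • d ∈ interior T.S) : φ ⬝ᵥ d ≤ 0 := by
  by_contra hpos
  rw [not_le] at hpos
  set w := φ ⬝ᵥ (v - T.xbar) with hw
  have hw1 : w < 1 := hφ.lt v (by simpa using h 0 le_rfl)
  -- The parameter at which φ would reach the value 1 on the half-line.
  have := hφ.lt _ (h ((1 - w) / (φ ⬝ᵥ d)) (div_nonneg (by linarith) hpos.le))
  rw [add_sub_right_comm, dotProduct_add, dotProduct_smul, smul_eq_mul,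
    div_mul_cancel₀ _ hpos.ne', ← hw] at this
  linarith

/-- A direction of recession of the interior of `S` at one point is one at every point. -/
theorem recession_of_recession {v d y : Fin n → ℝ}
    (h : ∀ t : ℝ, 0 ≤ t → v + t • d ∈ interior T.S) (hy : y ∈ interior T.S) :
    ∀ t : ℝ, 0 ≤ t → y + t • d ∈ interior T.S := by
  intro t ht
  by_contra hout
  obtain ⟨φ, hφ, h1⟩ := T.exists_bounds_eq_one hout
  rw [add_sub_right_comm, dotProduct_add, dotProduct_smul, smul_eq_mul] at h1
  have := hφ.lt y hy
  nlinarith [hφ.dotProduct_nonpos h]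

theorem Bounds.vec_exit_le {φ : Fin n → ℝ} (hφ : T.Bounds φ) {v : Fin n → ℝ} (d : Fin n → ℝ)
    (hv : v ∈ interior T.S) : φ ⬝ᵥ (T.exit v d).vec T.xbar ≤ (T.exit v d).height := by
  rcases T.exit_cases d hv with ⟨he, hr⟩ | ⟨t, -, he, hf, -⟩ <;> rw [he]
  · exact hφ.dotProduct_nonpos hr
  · exact hφ.le _ (T.S_closed.frontier_subset hf)

variable (T)

theorem exists_bounds_vec_exit_eq {v : Fin n → ℝ} (d : Fin n → ℝ) (hv : v ∈ interior T.S) :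
    ∃ φ, T.Bounds φ ∧ φ ⬝ᵥ (T.exit v d).vec T.xbar = (T.exit v d).height := by
  rcases T.exit_cases d hv with ⟨he, -⟩ | ⟨t, -, he, hf, -⟩ <;> rw [he]
  · exact ⟨0, T.bounds_zero, by simp [PointOrRay.height]⟩
  · exact T.exists_bounds_eq_one hf.2

/-! ### Coordinates along the rays of the cone -/

/-- The coordinate of the displacement `v` along ray `k` of the cone. -/
noncomputable def coord (k : Fin n) (v : Fin n → ℝ) : ℝ :=
  ((T.hyp (T.cobasis k)).a ⬝ᵥ v) / ((T.hyp (T.cobasis k)).a ⬝ᵥ T.ray k)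

theorem coord_ray_self (k : Fin n) : T.coord k (T.ray k) = 1 :=
  div_self (T.ray_pos k).ne'

theorem coord_ray_of_ne {k j : Fin n} (h : k ≠ j) : T.coord k (T.ray j) = 0 := by
  simp [coord, T.ray_facet k j h]

theorem coord_ray (k j : Fin n) : T.coord k (T.ray j) = if k = j then 1 else 0 := by
  split_ifs with h
  · rw [h, T.coord_ray_self]
  · exact T.coord_ray_of_ne h

theorem coord_smul (k : Fin n) (c : ℝ) (v : Fin n → ℝ) : T.coord k (c • v) = c * T.coord k v := by
  simp [coord, dotProduct_smul, mul_div_assoc]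

theorem coord_sum (k : Fin n) (c : Fin n → ℝ) : T.coord k (∑ j, c j • T.ray j) = c k := by
  have : T.coord k (∑ j, c j • T.ray j) = ∑ j, c j * T.coord k (T.ray j) := by
    simp [coord, dotProduct_sum, Finset.sum_div, mul_div_assoc]
  simp [this, coord_ray]

theorem linearIndependent_ray : LinearIndependent ℝ T.ray := by
  rw [Fintype.linearIndependent_iff]
  intro c hc k
  rw [← T.coord_sum k c, hc]
  simp [coord]

theorem sum_coord_smul_ray (v : Fin n → ℝ) : ∑ k, T.coord k v • T.ray k = v := by
  have hspan := T.linearIndependent_ray.span_eq_top_of_card_eq_finrank' (by simp)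
  obtain ⟨c, hc⟩ := (Submodule.mem_span_range_iff_exists_fun ℝ).mp
    (hspan ▸ Submodule.mem_top : v ∈ Submodule.span ℝ (Set.range T.ray))
  rw [← hc]
  simp [coord_sum]

theorem dotProduct_eq_sum (φ v : Fin n → ℝ) : φ ⬝ᵥ v = ∑ k, T.coord k v * (φ ⬝ᵥ T.ray k) := by
  conv_lhs => rw [← T.sum_coord_smul_ray v]
  simp [dotProduct_sum]

theorem eq_of_dotProduct_ray {φ ψ : Fin n → ℝ} (h : ∀ k, φ ⬝ᵥ T.ray k = ψ ⬝ᵥ T.ray k) : φ = ψ :=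
  dotProduct_eq _ _ fun v => by simp [T.dotProduct_eq_sum _ v, h]

theorem exists_dotProduct_ray (w : Fin n → ℝ) : ∃ φ : Fin n → ℝ, ∀ k, φ ⬝ᵥ T.ray k = w k := by
  refine ⟨∑ j, (w j / ((T.hyp (T.cobasis j)).a ⬝ᵥ T.ray j)) • (T.hyp (T.cobasis j)).a,
    fun k => ?_⟩
  rw [sum_dotProduct, Finset.sum_eq_single k]
  · rw [smul_dotProduct, smul_eq_mul, div_mul_cancel₀ _ (T.ray_pos k).ne']
  · intro j _ hj
    simp [T.ray_facet j k hj]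
  · simp

theorem coord_nonneg_of_mem_P {x : Fin n → ℝ} (hx : x ∈ T.P) (k : Fin n) :
    0 ≤ T.coord k (x - T.xbar) := by
  refine div_nonneg ?_ (T.ray_pos k).le
  have h1 : (T.hyp (T.cobasis k)).b ≤ (T.hyp (T.cobasis k)).a ⬝ᵥ x := hx _
  have h2 : (T.hyp (T.cobasis k)).a ⬝ᵥ T.xbar = (T.hyp (T.cobasis k)).b := T.xbar_tight k
  rw [dotProduct_sub]
  linarith

end Data

end GIC

/-! ### Gauges of halfspaces and cut rays -/

namespace GIC

open PointOrRay

namespace Data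

variable {n : ℕ} (T : Data n)

/-- `xbar` lies in the interior of `H⁺`. -/
def StrictlyInside (H : Hyperplane n) : Prop := H.b < H.a ⬝ᵥ T.xbar

/-- The linear form for which `H⁺` is `{x | gauge (x - xbar) ≤ 1}`. -/
noncomputable def gauge (H : Hyperplane n) : Fin n → ℝ := -(H.a ⬝ᵥ T.xbar - H.b)⁻¹ • H.a

variable {T} {H : Hyperplane n}

theorem strictlyInside_of_valid (hvalid : T.P ⊆ H.pos) (h : T.xbar ∉ H.carrier) :
    T.StrictlyInside H :=
  lt_of_le_of_ne (hvalid T.xbar_mem) fun he => h he.symm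

theorem gauge_dotProduct (v : Fin n → ℝ) :
    T.gauge H ⬝ᵥ v = -(H.a ⬝ᵥ v) / (H.a ⬝ᵥ T.xbar - H.b) := by
  rw [gauge, smul_dotProduct, smul_eq_mul]
  ring

theorem gauge_vec_sub_height (hH : T.StrictlyInside H) (q : PointOrRay n) :
    T.gauge H ⬝ᵥ q.vec T.xbar - q.height =
      (match q with
        | .point x => H.b - H.a ⬝ᵥ x
        | .ray d => -(H.a ⬝ᵥ d)) / (H.a ⬝ᵥ T.xbar - H.b) := by
  have h : H.a ⬝ᵥ T.xbar - H.b ≠ 0 := (sub_pos.mpr hH).ne'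
  cases q <;> rw [gauge_dotProduct] <;> simp only [vec, height, dotProduct_sub]
  · field_simp
    ring
  · ring

theorem violates_iff (hH : T.StrictlyInside H) (q : PointOrRay n) :
    q.Violates H ↔ q.height < T.gauge H ⬝ᵥ q.vec T.xbar := by
  rw [← sub_pos, gauge_vec_sub_height hH, div_pos_iff_of_pos_right (sub_pos.mpr hH)]
  cases q <;> simp [Violates]

theorem on_iff (hH : T.StrictlyInside H) (q : PointOrRay n) :
    q.On H ↔ T.gauge H ⬝ᵥ q.vec T.xbar = q.height := by
  rw [← sub_eq_zero, gauge_vec_sub_height hH, div_eq_zero_iff,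
    or_iff_left (sub_pos.mpr hH).ne']
  cases q
  · simp [On, sub_eq_zero, eq_comm]
  · simp [On]

theorem mem_carrier_iff (hH : T.StrictlyInside H) (x : Fin n → ℝ) :
    x ∈ H.carrier ↔ T.gauge H ⬝ᵥ (x - T.xbar) = 1 :=
  on_iff hH (.point x)

theorem gauge_le_one_of_mem_pos (hH : T.StrictlyInside H) {x : Fin n → ℝ} (hx : x ∈ H.pos) :
    T.gauge H ⬝ᵥ (x - T.xbar) ≤ 1 := by
  have := violates_iff hH (.point x)
  exact not_lt.mp (this.not.mp (not_lt.mpr hx))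

theorem distance_eq (j : Fin n) :
    (H.b - H.a ⬝ᵥ T.xbar) / (H.a ⬝ᵥ T.ray j) = (T.gauge H ⬝ᵥ T.ray j)⁻¹ := by
  rw [gauge_dotProduct, inv_div, ← neg_div_neg_eq, neg_sub]

theorem vertex_eq (H : Hyperplane n) (j : Fin n) :
    T.vertex H j = T.xbar + (T.gauge H ⬝ᵥ T.ray j)⁻¹ • T.ray j := by
  rw [vertex, distance_eq]

theorem newEdge_dir (hH : T.StrictlyInside H) (j k : Fin n) :
    (T.newEdge H j k).dir =
      T.ray k - ((T.gauge H ⬝ᵥ T.ray k) / (T.gauge H ⬝ᵥ T.ray j)) • T.ray j := by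
  have h : H.a ⬝ᵥ T.xbar - H.b ≠ 0 := (sub_pos.mpr hH).ne'
  rw [newEdge, gauge_dotProduct, gauge_dotProduct, div_div_div_cancel_right₀ h, neg_div_neg_eq]

theorem vHyp_eq (hH : T.StrictlyInside H) (j : Fin n) : T.vHyp H j =
    open Classical in
    if T.gauge H ⬝ᵥ T.ray j = 0 then .ray (T.ray j)
    else .point (T.xbar + (T.gauge H ⬝ᵥ T.ray j)⁻¹ • T.ray j) := by
  have h : T.gauge H ⬝ᵥ T.ray j = 0 ↔ H.a ⬝ᵥ T.ray j = 0 := by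
    rw [gauge_dotProduct, div_eq_zero_iff, or_iff_left (sub_pos.mpr hH).ne', neg_eq_zero]
  simp only [vHyp, distance_eq, h]

theorem mem_cutRays_iff (hH : T.StrictlyInside H) (j : Fin n) :
    j ∈ T.cutRays H ↔ 0 < T.gauge H ⬝ᵥ T.ray j ∧ T.vertex H j ∈ interior T.S := by
  have h : 0 < T.gauge H ⬝ᵥ T.ray j ↔ H.a ⬝ᵥ T.ray j < 0 := by
    rw [gauge_dotProduct, div_pos_iff_of_pos_right (sub_pos.mpr hH), neg_pos]
  rw [vertex_eq]
  simp only [cutRays, Set.mem_ofPred_eq, distHyp, distance_eq]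
  split_ifs with hneg
  · have hpos := h.mpr hneg
    rw [T.lt_distBd_iff T.xbar_mem_interior (inv_nonneg.mpr hpos.le)]
    exact ⟨fun h => ⟨hpos, h⟩, fun h => h.2⟩
  · simp [h, hneg]

theorem exists_vec_vBd (T : Data n) (k : Fin n) :
    ∃ c : ℝ, 0 < c ∧ (T.vBd k).vec T.xbar = c • T.ray k := by
  rcases T.exit_cases (T.ray k) T.xbar_mem_interior with ⟨he, -⟩ | ⟨t, ht, he, -⟩ <;>
    rw [vBd, he]
  · exact ⟨1, one_pos, by simp [vec]⟩
  · exact ⟨t, ht, by simp [vec]⟩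

/-- A ray of the cone is cut by `H` if and only if its exit from `S` violates `H`. -/
theorem mem_cutRays_iff_violates (hH : T.StrictlyInside H) (k : Fin n) :
    k ∈ T.cutRays H ↔ (T.vBd k).height < T.gauge H ⬝ᵥ (T.vBd k).vec T.xbar := by
  rw [mem_cutRays_iff hH, vertex_eq]
  rcases T.exit_cases (T.ray k) T.xbar_mem_interior with ⟨he, hr⟩ | ⟨t, ht, he, hf, hint⟩ <;>
    rw [vBd, he]
  · exact ⟨fun h => h.1, fun h => ⟨h, hr _ (inv_nonneg.mpr (le_of_lt h))⟩⟩
  · simp only [vec, height, add_sub_cancel_left, dotProduct_smul, smul_eq_mul]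
    constructor
    · rintro ⟨hpos, hmem⟩
      have hlt : (T.gauge H ⬝ᵥ T.ray k)⁻¹ < t := by
        by_contra hle
        rw [not_lt] at hle
        rcases hle.eq_or_lt with heq | hlt
        · exact hf.2 (heq ▸ hmem)
        · exact hf.2 (T.add_smul_mem_interior_of_le T.xbar_mem_interior ht.le hlt
            (interior_subset hmem))
      rwa [inv_lt_iff_one_lt_mul₀ hpos] at hlt
    · intro h
      have hpos : 0 < T.gauge H ⬝ᵥ T.ray k := pos_of_mul_pos_right (one_pos.trans h) ht.le
      refine ⟨hpos, hint _ (inv_nonneg.mpr hpos.le) ?_⟩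
      rwa [inv_lt_iff_one_lt_mul₀ hpos]

/-- At the vertex where H meets the ray the gauge is 1, while φ < 1 because that vertex is interior
to S. -/
theorem Bounds.ray_lt_gauge {φ : Fin n → ℝ} (hφ : T.Bounds φ) (hH : T.StrictlyInside H)
    {j : Fin n} (hj : j ∈ T.cutRays H) : φ ⬝ᵥ T.ray j < T.gauge H ⬝ᵥ T.ray j := by
  obtain ⟨hpos, hmem⟩ := (mem_cutRays_iff hH j).mp hj
  have := hφ.lt _ hmem
  rwa [vertex_eq, add_sub_cancel_left, dotProduct_smul, smul_eq_mul, inv_mul_lt_one₀ hpos] at this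

/-! ### New edges along H -/

theorem newEdge_point (hH : T.StrictlyInside H) (j k : Fin n) (t : ℝ) :
    (T.newEdge H j k).start + t • (T.newEdge H j k).dir = T.xbar +
      (((1 - t * (T.gauge H ⬝ᵥ T.ray k)) / (T.gauge H ⬝ᵥ T.ray j)) • T.ray j + t • T.ray k) := by
  rw [newEdge_dir hH]
  simp only [newEdge, vertex_eq, smul_sub, smul_smul, sub_div, sub_smul, one_div, mul_div_assoc]
  abel

/-- Only the `j`-th hyperplane of the cone misses ray `j`, and the edge can meet it only at the
vertex of H on ray `k`. That vertex is interior to S exactly when `k` is cut. -/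
theorem hitsCone_newEdge_iff (hH : T.StrictlyInside H) {j k : Fin n} (hj : j ∈ T.cutRays H)
    (hjk : k ≠ j) : T.HitsCone (T.newEdge H j k) j ↔ k ∈ T.cutRays H := by
  obtain ⟨hpos, hmem⟩ := (mem_cutRays_iff hH j).mp hj
  have hstart : (T.newEdge H j k).start ∈ interior T.S := hmem
  have hcarrier : ∀ t : ℝ, (T.newEdge H j k).start + t • (T.newEdge H j k).dir ∈
      (T.hyp (T.cobasis j)).carrier ↔ t * (T.gauge H ⬝ᵥ T.ray k) = 1 := by
    intro t
    have h1 := T.ray_pos j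
    have h2 : (T.hyp (T.cobasis j)).a ⬝ᵥ T.xbar = (T.hyp (T.cobasis j)).b := T.xbar_tight j
    rw [newEdge_point hH, Hyperplane.carrier, Set.mem_ofPred_eq, ← h2]
    simp only [dotProduct_add, dotProduct_smul, smul_eq_mul, T.ray_facet j k hjk.symm]
    rw [mul_zero, add_zero, add_eq_left, mul_eq_zero, or_iff_left h1.ne', div_eq_zero_iff,
      or_iff_left hpos.ne', sub_eq_zero, eq_comm]
  have hpoint : ∀ t : ℝ, t * (T.gauge H ⬝ᵥ T.ray k) = 1 →
      (T.newEdge H j k).start + t • (T.newEdge H j k).dir = T.vertex H k := by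
    intro t ht
    rw [newEdge_point hH, ht, vertex_eq, eq_inv_of_mul_eq_one_left ht]
    simp
  rw [mem_cutRays_iff hH k]
  constructor
  · rintro ⟨i, hi, t, ht, hlt, hc⟩
    obtain rfl : i = j := by
      by_contra hne
      exact hi (T.ray_facet i j hne)
    have h1 := (hcarrier t).mp hc
    rw [T.lt_distBd_iff hstart ht, hpoint t h1] at hlt
    exact ⟨pos_of_mul_pos_right (h1 ▸ one_pos) ht, hlt⟩
  · rintro ⟨hk, hkmem⟩
    have h1 := inv_mul_cancel₀ hk.ne'
    refine ⟨j, (T.ray_pos j).ne', (T.gauge H ⬝ᵥ T.ray k)⁻¹, inv_nonneg.mpr hk.le, ?_,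
      (hcarrier _).mpr h1⟩
    rw [T.lt_distBd_iff hstart (inv_nonneg.mpr hk.le), hpoint _ h1]
    exact hkmem

/-- The coefficient of ray `j` could turn negative only beyond the vertex of H on ray `k`. As `k` is
not cut, the edge leaves S no later than there. -/
theorem newEdge_vec (hH : T.StrictlyInside H) {j k : Fin n} (hj : j ∈ T.cutRays H)
    (hk : k ∉ T.cutRays H) : ∃ c d : ℝ, 0 ≤ c ∧ 0 < d ∧
      (T.element (T.newEdge H j k)).vec T.xbar = c • T.ray j + d • T.ray k := by
  obtain ⟨hpos, hmem⟩ := (mem_cutRays_iff hH j).mp hj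
  have hvk : 0 < T.gauge H ⬝ᵥ T.ray k → (T.newEdge H j k).start +
      (T.gauge H ⬝ᵥ T.ray k)⁻¹ • (T.newEdge H j k).dir ∉ interior T.S := by
    intro hgk hin
    refine hk ((mem_cutRays_iff hH k).mpr ⟨hgk, ?_⟩)
    rwa [newEdge_point hH, inv_mul_cancel₀ hgk.ne', sub_self, zero_div, zero_smul, zero_add,
      ← vertex_eq] at hin
  rcases T.exit_cases (T.newEdge H j k).dir (v := (T.newEdge H j k).start) hmem with
    ⟨he, hr⟩ | ⟨t, ht, he, -, hint⟩ <;> rw [element, he]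
  · refine ⟨-((T.gauge H ⬝ᵥ T.ray k) / (T.gauge H ⬝ᵥ T.ray j)), 1, ?_, one_pos, ?_⟩
    · rw [Left.nonneg_neg_iff]
      refine div_nonpos_of_nonpos_of_nonneg ?_ hpos.le
      by_contra hgk
      rw [not_le] at hgk
      exact hvk hgk (hr _ (inv_nonneg.mpr hgk.le))
    · rw [vec, newEdge_dir hH, one_smul, neg_smul]
      abel
  · refine ⟨(1 - t * (T.gauge H ⬝ᵥ T.ray k)) / (T.gauge H ⬝ᵥ T.ray j), t, ?_, ht, ?_⟩
    · refine div_nonneg ?_ hpos.le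
      by_contra hlt
      rw [not_le, sub_neg] at hlt
      have hgk : 0 < T.gauge H ⬝ᵥ T.ray k := pos_of_mul_pos_right (one_pos.trans hlt) ht.le
      refine hvk hgk (hint _ (inv_nonneg.mpr hgk.le) ?_)
      rwa [inv_lt_iff_one_lt_mul₀ hgk]
    · rw [vec, newEdge_point hH, add_sub_cancel_left]

theorem gauge_newEdge_element (hH : T.StrictlyInside H) {j : Fin n} (hj : j ∈ T.cutRays H)
    (k : Fin n) : T.gauge H ⬝ᵥ (T.element (T.newEdge H j k)).vec T.xbar =
      (T.element (T.newEdge H j k)).height := by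
  obtain ⟨hpos, hmem⟩ := (mem_cutRays_iff hH j).mp hj
  rcases T.exit_cases (T.newEdge H j k).dir (v := (T.newEdge H j k).start) hmem with
    ⟨he, -⟩ | ⟨t, -, he, -⟩ <;> rw [element, he]
  · simp only [vec, height, newEdge_dir hH, dotProduct_sub, dotProduct_smul, smul_eq_mul]
    field_simp
    ring
  · simp only [vec, height, newEdge_point hH, add_sub_cancel_left, dotProduct_add,
      dotProduct_smul, smul_eq_mul]
    field_simp
    ring

/-! ### The outcome of a whole call -/

/-- The condition under which the pass for ray `j` removes the edge `e`. -/
def Removes (T : Data n) (H : Hyperplane n) (RA : Set (Fin n)) (j : Fin n) (e : Edge n) : Prop :=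
  (T.element e).Violates H ∧ T.OriginatesFrom e j ∧ ¬ ∃ k, k ∉ RA ∧ T.LiesOnRay k (T.element e)

/-- New elements lie on H, so no later pass removes them and the order of the passes is irrelevant.
The condition k ≠ j is absorbed by k not being cut. -/
theorem mem_PHA1_iff (hH : T.StrictlyInside H) {RA : Set (Fin n)} {D : Set (Edge n)}
    {e : Edge n} : e ∈ T.PHA1 H RA D ↔
      (e ∈ D ∧ ∀ j ∈ RA ∩ T.cutRays H, ¬ T.Removes H RA j e) ∨
      ∃ j ∈ RA ∩ T.cutRays H, ∃ k ∉ T.cutRays H, e = T.newEdge H j k := by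
  classical
  have hkeep : ∀ i, ∀ j ∈ RA ∩ T.cutRays H, ∀ k, ¬ T.Removes H RA i (T.newEdge H j k) := by
    intro i j hj k hrem
    have := (violates_iff hH _).mp hrem.1
    rw [gauge_newEdge_element hH hj.2] at this
    exact lt_irrefl _ this
  have hstep : ∀ j ∈ RA ∩ T.cutRays H, ∀ (D : Set (Edge n)) (e : Edge n),
      e ∈ T.activateRay H RA j D ↔ (e ∈ D ∧ ¬ T.Removes H RA j e) ∨
        ∃ k ∉ T.cutRays H, e = T.newEdge H j k := by
    intro j hj D e
    refine or_congr Iff.rfl (exists_congr fun k => ?_)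
    constructor
    · rintro ⟨hkj, rfl, hhit⟩
      exact ⟨fun hk => hhit ((hitsCone_newEdge_iff hH hj.2 hkj).mpr hk), rfl⟩
    · rintro ⟨hk, rfl⟩
      have hkj : k ≠ j := fun h => hk (h ▸ hj.2)
      exact ⟨hkj, rfl, fun hhit => hk ((hitsCone_newEdge_iff hH hj.2 hkj).mp hhit)⟩
  have hfold : ∀ (L : List (Fin n)) (D : Set (Edge n)), e ∈ L.foldl
      (fun D j => if j ∈ RA ∧ j ∈ T.cutRays H then T.activateRay H RA j D else D) D ↔
      (e ∈ D ∧ ∀ j ∈ L, j ∈ RA ∩ T.cutRays H → ¬ T.Removes H RA j e) ∨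
      ∃ j ∈ L, j ∈ RA ∩ T.cutRays H ∧ ∃ k ∉ T.cutRays H, e = T.newEdge H j k := by
    intro L
    induction L with
    | nil => simp
    | cons i L ih =>
      intro D
      rw [List.foldl_cons, ih]
      simp only [List.forall_mem_cons, List.exists_mem_cons_iff]
      split_ifs with hi
      · have hi' : i ∈ RA ∩ T.cutRays H := hi
        rw [hstep i hi']
        constructor
        · rintro (⟨⟨h1, h2⟩ | h1, h3⟩ | h)
          · exact Or.inl ⟨h1, fun _ => h2, h3⟩
          · exact Or.inr (Or.inl ⟨hi', h1⟩)
          · exact Or.inr (Or.inr h)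
        · rintro (⟨h1, h2, h3⟩ | ⟨-, h1⟩ | h)
          · exact Or.inl ⟨Or.inl ⟨h1, h2 hi'⟩, h3⟩
          · refine Or.inl ⟨Or.inr h1, fun j _ _ => ?_⟩
            obtain ⟨k, -, rfl⟩ := h1
            exact hkeep j i hi' k
          · exact Or.inr h
      · have hi' : i ∉ RA ∩ T.cutRays H := hi
        simp [hi']
  rw [PHA1, hfold]
  simp

/-! ### Edges occurring in a run -/

/-- An edge that the algorithm may create. -/
inductive Created (T : Data n) : Edge n → Prop
  | initial (k : Fin n) : Created T ⟨T.xbar, T.ray k⟩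
  | new (H : Hyperplane n) (j k : Fin n) : T.StrictlyInside H → j ∈ T.cutRays H →
      k ∉ T.cutRays H → Created T (T.newEdge H j k)

theorem Created.start_mem {e : Edge n} (he : T.Created e) : e.start ∈ interior T.S := by
  cases he with
  | initial k => exact T.xbar_mem_interior
  | new H j k hH hj hk => exact ((mem_cutRays_iff hH j).mp hj).2

theorem originatesFrom_newEdge (hH : T.StrictlyInside H) {i j k : Fin n}
    (hj : j ∈ T.cutRays H) (h : T.OriginatesFrom (T.newEdge H j k) i) : i = j := by
  obtain ⟨t, -, ht⟩ := h
  have hpos := ((mem_cutRays_iff hH j).mp hj).1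
  rw [newEdge, vertex_eq, add_right_inj] at ht
  have := congrArg (T.coord j) ht
  rw [coord_smul, coord_smul, coord_ray_self] at this
  by_contra hne
  rw [T.coord_ray_of_ne (Ne.symm hne), mul_zero, mul_one] at this
  exact (inv_pos.mpr hpos).ne' this

/-- The element of a created edge that originates from ray `j` lies in a face spanned by `j` and
another ray, or on a ray of the cone. -/
theorem Created.vec_of_originatesFrom {e : Edge n} (he : T.Created e) {j : Fin n}
    (h : T.OriginatesFrom e j) : ∃ (k : Fin n) (c d : ℝ), 0 ≤ c ∧ 0 < d ∧
      (T.element e).vec T.xbar = c • T.ray j + d • T.ray k := by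
  cases he with
  | initial k =>
    obtain ⟨c, hc, hv⟩ := T.exists_vec_vBd k
    exact ⟨k, 0, c, le_rfl, hc, by simpa [vBd, element] using hv⟩
  | new H i k hH hi hk =>
    obtain rfl := originatesFrom_newEdge hH hi h
    exact ⟨k, newEdge_vec hH hi hk⟩

theorem Created.vec_nonneg {e : Edge n} (he : T.Created e) : ∃
    (j k : Fin n) (c d : ℝ), 0 ≤ c ∧ 0 < d ∧
      (T.element e).vec T.xbar = c • T.ray j + d • T.ray k := by
  cases he with
  | initial k => exact ⟨k, (Created.initial k).vec_of_originatesFrom ⟨0, le_rfl, by simp⟩⟩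
  | new H i k hH hi hk => exact ⟨i, k, newEdge_vec hH hi hk⟩

theorem liesOnRay_of_vec {q : PointOrRay n} {k : Fin n} {c : ℝ} (hc : 0 < c)
    (h : q.vec T.xbar = c • T.ray k) : T.LiesOnRay k q := by
  cases q with
  | point x => exact ⟨c, hc.le, by rw [← h, vec]; simp⟩
  | ray d => exact ⟨c, hc, h⟩

/-- If the element of a created edge lies on ray `k` and violates `H`, then `H` cuts ray `k`. -/
theorem Created.mem_cutRays_of_liesOnRay {e : Edge n} (he : T.Created e)
    (hH : T.StrictlyInside H) {k : Fin n} (hk : T.LiesOnRay k (T.element e))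
    (hv : (T.element e).Violates H) : k ∈ T.cutRays H := by
  rw [violates_iff hH] at hv
  rw [mem_cutRays_iff_violates hH]
  rcases T.exit_cases e.dir he.start_mem with ⟨heq, hr⟩ | ⟨t, -, heq, hf, -⟩ <;>
    rw [element, heq] at hk hv
  · obtain ⟨s, hs, hd⟩ := hk
    have hrec : T.vBd k = .ray (T.ray k) := by
      refine T.exit_eq_ray fun t ht => ?_
      have := recession_of_recession hr T.xbar_mem_interior (t / s) (by positivity)
      rwa [hd, smul_smul, div_mul_cancel₀ _ hs.ne'] at this
    rw [hrec]
    simp only [vec, height, hd, dotProduct_smul, smul_eq_mul] at hv ⊢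
    exact pos_of_mul_pos_right hv hs.le
  · obtain ⟨s, hs, hx⟩ := hk
    rw [hx] at hf hv
    rwa [vBd, T.exit_eq_point T.xbar_mem_interior hs hf]

theorem Run.created {D : Set (Edge n)} {Rc : Set (Fin n)} (h : T.Run D Rc) :
    ∀ e ∈ D, T.Created e := by
  induction h with
  | init =>
    rintro _ ⟨j, rfl⟩
    exact .initial j
  | step H RA _ hvalid hnon ih =>
    have hH := strictlyInside_of_valid hvalid hnon
    intro e he
    rcases (mem_PHA1_iff hH).mp he with ⟨h, -⟩ | ⟨j, hj, k, hk, rfl⟩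
    · exact ih e h
    · exact .new H j k hH hj.2 hk

/-- The edge on a ray that has not been cut belongs to the collection. -/
theorem Run.initial_mem {D : Set (Edge n)} {Rc : Set (Fin n)} (h : T.Run D Rc) :
    ∀ k ∉ Rc, (⟨T.xbar, T.ray k⟩ : Edge n) ∈ D := by
  induction h with
  | init => exact fun k _ => ⟨k, rfl⟩
  | step H RA _ hvalid hnon ih =>
    have hH := strictlyInside_of_valid hvalid hnon
    intro k hk
    rw [Set.mem_union, not_or] at hk
    refine (mem_PHA1_iff hH).mpr (Or.inl ⟨ih k hk.1, fun j hj hrem => ?_⟩)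
    have hlies : T.LiesOnRay k (T.vBd k) := by
      obtain ⟨c, hc, hv⟩ := T.exists_vec_vBd k
      exact liesOnRay_of_vec hc hv
    by_cases hkRA : k ∈ RA
    · exact hk.2 ⟨hkRA, (Created.initial k).mem_cutRays_of_liesOnRay hH hlies hrem.1⟩
    · exact hrem.2.2 ⟨k, hkRA, hlies⟩

end Data

end GIC

/-! ### Properness is preserved -/

namespace GIC

open PointOrRay

namespace Data

variable {n : ℕ} {T : Data n}

/-- Properness in terms of linear forms centred at `xbar`. -/
theorem proper_iff {D : Set (Edge n)} : T.Proper (T.points D) (T.rays D) ↔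
    ∀ φ : Fin n → ℝ, (∀ e ∈ D, (T.element e).height ≤ φ ⬝ᵥ (T.element e).vec T.xbar) →
      ∀ x ∈ T.PI, 1 ≤ φ ⬝ᵥ (x - T.xbar) := by
  constructor
  · intro h φ hφ x hx
    have := h φ (1 + φ ⬝ᵥ T.xbar) ?_ ?_ (by linarith) x hx
    · rw [dotProduct_sub]
      linarith
    · rintro p ⟨e, he, hp⟩
      have := hφ e he
      rw [hp] at this
      simp only [vec, height, dotProduct_sub] at this
      linarith
    · rintro d ⟨e, he, hd⟩
      have := hφ e he
      rwa [hd] at this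
  · intro h α β hp hd hα x hx
    have hc : 0 < β - α ⬝ᵥ T.xbar := sub_pos.mpr hα
    have := h ((β - α ⬝ᵥ T.xbar)⁻¹ • α) (fun e he => ?_) x hx
    · rw [smul_dotProduct, smul_eq_mul, inv_mul_eq_div, one_le_div hc, dotProduct_sub] at this
      linarith
    · rw [smul_dotProduct, smul_eq_mul, inv_mul_eq_div]
      cases hq : T.element e with
      | point p =>
        have := hp p ⟨e, he, hq⟩
        rw [vec, height, one_le_div hc, dotProduct_sub]
        linarith
      | ray d => exact div_nonneg (hd d ⟨e, he, hq⟩) hc.le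

variable (T) in
/-- A linear form that is large on all points and nonnegative on all rays of any collection. -/
theorem exists_dominating_form :
    ∃ γ : Fin n → ℝ, ∀ e, T.Created e → (T.element e).height ≤ γ ⬝ᵥ (T.element e).vec T.xbar := by
  choose c hc hv using T.exists_vec_vBd
  obtain ⟨γ, hγ⟩ := T.exists_dotProduct_ray fun k => (c k)⁻¹
  refine ⟨γ, fun e he => ?_⟩
  obtain ⟨φ, hφ, heq⟩ := T.exists_bounds_vec_exit_eq e.dir he.start_mem
  -- γ has the value 1 at the exit of each cone ray, so it dominates every bounding form on the
  -- rays; here φ is one that is tight at the given element.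
  have hle : ∀ k, φ ⬝ᵥ T.ray k ≤ γ ⬝ᵥ T.ray k := by
    intro k
    have h1 := hφ.vec_exit_le (T.ray k) T.xbar_mem_interior
    have h2 := hv k
    rw [vBd] at h2
    rw [h2, dotProduct_smul, smul_eq_mul] at h1
    rw [hγ, ← one_div, le_div_iff₀ (hc k), mul_comm]
    exact h1.trans (height_le_one _)
  obtain ⟨j, k, a, b, ha, hb, hab⟩ := he.vec_nonneg
  have h1 : φ ⬝ᵥ (T.element e).vec T.xbar = (T.element e).height := heq
  rw [← h1, hab]
  simp only [dotProduct_add, dotProduct_smul, smul_eq_mul]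
  have h2 := mul_le_mul_of_nonneg_left (hle j) ha
  have h3 := mul_le_mul_of_nonneg_left (hle k) hb.le
  linarith

/-- A linear form that is nonnegative on a proper collection is nonnegative on `P_I`. -/
theorem nonneg_of_proper {D : Set (Edge n)} (hD : ∀ e ∈ D, T.Created e)
    (hproper : T.Proper (T.points D) (T.rays D)) {δ : Fin n → ℝ}
    (hδ : ∀ e ∈ D, 0 ≤ δ ⬝ᵥ (T.element e).vec T.xbar) {x : Fin n → ℝ} (hx : x ∈ T.PI) :
    0 ≤ δ ⬝ᵥ (x - T.xbar) := by
  obtain ⟨γ, hγ⟩ := T.exists_dominating_form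
  by_contra hneg
  rw [not_le] at hneg
  set g := γ ⬝ᵥ (x - T.xbar) with hg
  -- With this multiple, γ + Mδ is at most 0 at x, which contradicts the bound 1 from properness.
  set M := |g| / -(δ ⬝ᵥ (x - T.xbar)) with hM
  have hM0 : 0 ≤ M := div_nonneg (abs_nonneg _) (by linarith)
  have := proper_iff.mp hproper (γ + M • δ) (fun e he => ?_) x hx
  · rw [add_dotProduct, smul_dotProduct, smul_eq_mul, ← hg] at this
    have h1 : M * (δ ⬝ᵥ (x - T.xbar)) = -|g| := by
      rw [hM, div_neg, neg_mul, div_mul_cancel₀ _ hneg.ne]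
    linarith [le_abs_self g]
  · rw [add_dotProduct, smul_dotProduct, smul_eq_mul]
    have := mul_nonneg hM0 (hδ e he)
    linarith [hγ e (hD e he)]

theorem dotProduct_le_of_ray_le {φ ψ : Fin n → ℝ} (h : ∀ k, φ ⬝ᵥ T.ray k ≤ ψ ⬝ᵥ T.ray k)
    {x : Fin n → ℝ} (hx : x ∈ T.P) : φ ⬝ᵥ (x - T.xbar) ≤ ψ ⬝ᵥ (x - T.xbar) := by
  rw [T.dotProduct_eq_sum φ, T.dotProduct_eq_sum ψ]
  exact Finset.sum_le_sum fun k _ =>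
    mul_le_mul_of_nonneg_left (h k) (T.coord_nonneg_of_mem_P hx k)

/-- If a created edge in the face of the rays `j` and `k` leads to an element that violates `H`,
then that element is closer to ray `j` than the one of the edge along `H`. -/
theorem nonneg_of_nonneg_newEdge {H : Hyperplane n} (hH : T.StrictlyInside H) {e : Edge n}
    (he : T.Created e) {j k : Fin n} (hj : j ∈ T.cutRays H) (hk : k ∉ T.cutRays H) {c d : ℝ}
    (hd : 0 < d) (hvec : (T.element e).vec T.xbar = c • T.ray j + d • T.ray k)
    (hviol : (T.element e).height < T.gauge H ⬝ᵥ (T.element e).vec T.xbar) {δ : Fin n → ℝ}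
    (hδj : 0 ≤ δ ⬝ᵥ T.ray j)
    (hδ : 0 ≤ δ ⬝ᵥ (T.element (T.newEdge H j k)).vec T.xbar) :
    0 ≤ δ ⬝ᵥ (T.element e).vec T.xbar := by
  have hstart := ((mem_cutRays_iff hH j).mp hj).2
  obtain ⟨τ, hτ, hτeq⟩ := T.exists_bounds_vec_exit_eq (T.newEdge H j k).dir hstart
  have h1 : τ ⬝ᵥ (T.element (T.newEdge H j k)).vec T.xbar =
    (T.element (T.newEdge H j k)).height := hτeq
  have h2 := gauge_newEdge_element hH hj k
  have h3 : τ ⬝ᵥ (T.element e).vec T.xbar ≤ (T.element e).height :=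
    hτ.vec_exit_le e.dir he.start_mem
  have h4 := hτ.ray_lt_gauge hH hj
  obtain ⟨c', d', -, hd', hvec'⟩ := newEdge_vec hH hj hk
  rw [← h1, hvec'] at h2
  have h5 := h3.trans_lt hviol
  rw [hvec] at h5 ⊢
  rw [hvec'] at hδ
  simp only [dotProduct_add, dotProduct_smul, smul_eq_mul] at h2 h5 hδ ⊢
  set a := T.gauge H ⬝ᵥ T.ray j - τ ⬝ᵥ T.ray j with ha
  set b := T.gauge H ⬝ᵥ T.ray k - τ ⬝ᵥ T.ray k with hb
  have ha0 : 0 < a := sub_pos.mpr h4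
  have hq : c' * a + d' * b = 0 := by rw [ha, hb]; linarith
  have hp : 0 < c * a + d * b := by rw [ha, hb]; linarith
  -- The form gauge − τ vanishes on the new element and is positive on ray `j` and on the element of
  -- `e`. So a multiple of the latter is a positive part along ray `j` plus a positive multiple of
  -- the new element.
  have hcross : 0 < c * d' - d * c' := by
    have : a * (c * d' - d * c') = d' * (c * a + d * b) := by linear_combination -d * hq
    exact pos_of_mul_pos_right (this ▸ mul_pos hd' hp) ha0.le
  have hmul : d' * (c * (δ ⬝ᵥ T.ray j) + d * (δ ⬝ᵥ T.ray k)) =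
      (c * d' - d * c') * (δ ⬝ᵥ T.ray j) + d * (c' * (δ ⬝ᵥ T.ray j) + d' * (δ ⬝ᵥ T.ray k)) := by
    ring
  refine nonneg_of_mul_nonneg_right (a := d') ?_ hd'
  rw [hmul]
  exact add_nonneg (mul_nonneg hcross.le hδj) (mul_nonneg hd.le hδ)

theorem proper_PHA1 {H : Hyperplane n} (hvalid : T.P ⊆ H.pos) (hnondeg : T.xbar ∉ H.carrier)
    {D : Set (Edge n)} {Rc : Set (Fin n)} (hrun : T.Run D Rc)
    (hproper : T.Proper (T.points D) (T.rays D)) {R' : Set (Fin n)} (hsub : R' ⊆ T.cutRays H)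
    (hcut : Rc ∩ T.cutRays H ⊆ R') :
    T.Proper (T.points (T.PHA1 H R' D)) (T.rays (T.PHA1 H R' D)) := by
  have hH := strictlyInside_of_valid hvalid hnondeg
  have hD := hrun.created
  have hR : R' ∩ T.cutRays H = R' := Set.inter_eq_left.mpr hsub
  rw [proper_iff]
  intro α hα x hx
  obtain ⟨σ, hσ, hσx⟩ := T.exists_bounds_eq_one (T.S_free x hx.1 hx.2)
  set δ := α - σ with hδ
  have hold : ∀ e ∈ D, (∀ j ∈ R', ¬ T.Removes H R' j e) →
      (T.element e).height ≤ α ⬝ᵥ (T.element e).vec T.xbar := fun e he h =>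
    hα e ((mem_PHA1_iff hH).mpr (Or.inl ⟨he, by rwa [hR]⟩))
  have hnew : ∀ j ∈ R', ∀ k ∉ T.cutRays H, (T.element (T.newEdge H j k)).height ≤
      α ⬝ᵥ (T.element (T.newEdge H j k)).vec T.xbar := fun j hj k hk =>
    hα _ ((mem_PHA1_iff hH).mpr (Or.inr ⟨j, ⟨hj, hsub hj⟩, k, hk, rfl⟩))
  have hδ_of : ∀ e, T.Created e → (T.element e).height ≤ α ⬝ᵥ (T.element e).vec T.xbar →
      0 ≤ δ ⬝ᵥ (T.element e).vec T.xbar := by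
    intro e he h
    rw [hδ, sub_dotProduct, sub_nonneg]
    exact (hσ.vec_exit_le e.dir he.start_mem).trans h
  -- A spared cut ray still carries its original edge: it was never cut before, and being outside R'
  -- protects it now.
  have hδ_cut : ∀ k ∈ T.cutRays H, k ∉ R' → 0 ≤ δ ⬝ᵥ T.ray k := by
    intro k hk hkR
    obtain ⟨c, hc, hv⟩ := T.exists_vec_vBd k
    have h1 := hδ_of _ (.initial k) (hold _ (hrun.initial_mem k fun h => hkR (hcut ⟨h, hk⟩))
      fun j hj hrem => hrem.2.2 ⟨k, hkR, liesOnRay_of_vec hc hv⟩)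
    have h2 : (T.element ⟨T.xbar, T.ray k⟩).vec T.xbar = c • T.ray k := hv
    rw [h2, dotProduct_smul, smul_eq_mul] at h1
    exact nonneg_of_mul_nonneg_right h1 hc
  suffices hgoal : 0 ≤ δ ⬝ᵥ (x - T.xbar) by
    rw [hδ, sub_dotProduct, hσx] at hgoal
    linarith
  by_cases hneg : ∃ j ∈ R', δ ⬝ᵥ T.ray j < 0
  · obtain ⟨i, hi, hiδ⟩ := hneg
    have hgap : ∀ j ∈ T.cutRays H, 0 < T.gauge H ⬝ᵥ T.ray j - σ ⬝ᵥ T.ray j := fun j hj =>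
      sub_pos.mpr (hσ.ray_lt_gauge hH hj)
    obtain ⟨j, hj, hmax⟩ := Set.exists_max_image R'
      (fun j => -(δ ⬝ᵥ T.ray j) / (T.gauge H ⬝ᵥ T.ray j - σ ⬝ᵥ T.ray j)) R'.toFinite ⟨i, hi⟩
    set μ := -(δ ⬝ᵥ T.ray j) / (T.gauge H ⬝ᵥ T.ray j - σ ⬝ᵥ T.ray j) with hμ
    have hμ0 : 0 < μ := (div_pos (neg_pos.mpr hiδ) (hgap i (hsub hi))).trans_le (hmax i hi)
    have hμj : δ ⬝ᵥ T.ray j = μ * (σ ⬝ᵥ T.ray j - T.gauge H ⬝ᵥ T.ray j) := by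
      have := (hgap j (hsub hj)).ne'
      rw [hμ]
      field_simp
      ring
    have hray : ∀ k, (μ • (σ - T.gauge H)) ⬝ᵥ T.ray k ≤ δ ⬝ᵥ T.ray k := by
      intro k
      rw [smul_dotProduct, sub_dotProduct, smul_eq_mul]
      by_cases hk : k ∈ T.cutRays H
      · by_cases hkR : k ∈ R'
        · have := hmax k hkR
          rw [div_le_iff₀ (hgap k hk)] at this
          linarith
        · have := mul_pos hμ0 (hgap k hk)
          linarith [hδ_cut k hk hkR]
      -- On the new element σ ≤ gauge and δ ≥ 0, so δ ≥ μ(σ − gauge) there. Both sides agree on ray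
      -- `j` by the choice of μ, which leaves the inequality on ray `k`.
      · obtain ⟨c, d, -, hd, hvec⟩ := newEdge_vec hH (hsub hj) hk
        have hcr : T.Created (T.newEdge H j k) := .new H j k hH (hsub hj) hk
        have h1 := hδ_of _ hcr (hnew j hj k hk)
        have h2 : σ ⬝ᵥ _ ≤ _ := hσ.vec_exit_le (T.newEdge H j k).dir hcr.start_mem
        change σ ⬝ᵥ (T.element (T.newEdge H j k)).vec T.xbar ≤
          (T.element (T.newEdge H j k)).height at h2
        rw [← gauge_newEdge_element hH (hsub hj) k] at h2
        rw [hvec] at h1 h2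
        simp only [dotProduct_add, dotProduct_smul, smul_eq_mul] at h1 h2
        have h3 := mul_nonneg hμ0.le (sub_nonneg.mpr h2)
        have h4 : 0 ≤ d * (δ ⬝ᵥ T.ray k - μ * (σ ⬝ᵥ T.ray k - T.gauge H ⬝ᵥ T.ray k)) := by
          rw [hμj] at h1
          linarith
        linarith [nonneg_of_mul_nonneg_right h4 hd]
    refine le_trans ?_ (dotProduct_le_of_ray_le hray hx.1)
    rw [smul_dotProduct, sub_dotProduct, hσx, smul_eq_mul]
    exact mul_nonneg hμ0.le (sub_nonneg.mpr (gauge_le_one_of_mem_pos hH (hvalid hx.1)))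
  · push Not at hneg
    refine nonneg_of_proper hD hproper (fun e he => ?_) hx
    by_cases hrem : ∀ j ∈ R', ¬ T.Removes H R' j e
    · exact hδ_of e (hD e he) (hold e he hrem)
    push Not at hrem
    obtain ⟨j, hj, hviol, horig, -⟩ := hrem
    obtain ⟨k, c, d, hc, hd, hvec⟩ := (hD e he).vec_of_originatesFrom horig
    by_cases hk : 0 ≤ δ ⬝ᵥ T.ray k
    · rw [hvec, dotProduct_add, dotProduct_smul, dotProduct_smul, smul_eq_mul, smul_eq_mul]
      exact add_nonneg (mul_nonneg hc (hneg j hj)) (mul_nonneg hd.le hk)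
    · have hkR : k ∉ R' := fun h => hk (hneg k h)
      have hkcut : k ∉ T.cutRays H := fun h => hk (hδ_cut k h hkR)
      exact nonneg_of_nonneg_newEdge hH (hD e he) (hsub hj) hkcut hd hvec
        ((violates_iff hH _).mp hviol) (hneg j hj)
        (hδ_of _ (.new H j k hH (hsub hj) hkcut) (hnew j hj k hkcut))

/-! ### Targeted tiltings -/

/-- A targeted tilting has `xbar` strictly inside. -/
theorem IsTargetedTilting.strictlyInside {H Ht : Hyperplane n} (hH : T.StrictlyInside H)
    {R' : Set (Fin n)} (h : T.IsTargetedTilting H R' Ht) : T.StrictlyInside Ht := by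
  refine lt_of_le_of_ne h.xbar_mem fun heq => Ht.a_ne_zero ?_
  have hon : ∀ q : PointOrRay n, q.On Ht → Ht.a ⬝ᵥ q.vec T.xbar = 0 := by
    intro q hq
    cases q with
    | point x =>
      have hq : Ht.a ⬝ᵥ x = Ht.b := hq
      rw [vec, dotProduct_sub, hq, heq, sub_self]
    | ray d => exact hq
  refine T.eq_of_dotProduct_ray fun k => ?_
  rw [zero_dotProduct]
  by_cases hk : k ∈ T.cutRays H \ R'
  · obtain ⟨c, hc, hv⟩ := T.exists_vec_vBd k
    have := hon _ (h.tilted k hk)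
    rw [hv, dotProduct_smul, smul_eq_mul] at this
    exact (mul_eq_zero.mp this).resolve_left hc.ne'
  · have := hon _ (h.kept k hk)
    rw [vHyp_eq hH] at this
    split_ifs at this with h0
    · exact this
    · rw [vec, add_sub_cancel_left, dotProduct_smul, smul_eq_mul] at this
      exact (mul_eq_zero.mp this).resolve_left (inv_ne_zero h0)

theorem vHyp_on_iff {H Ht : Hyperplane n} (hH : T.StrictlyInside H) (hHt : T.StrictlyInside Ht)
    (k : Fin n) : (T.vHyp H k).On Ht ↔ T.gauge Ht ⬝ᵥ T.ray k = T.gauge H ⬝ᵥ T.ray k := by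
  rw [on_iff hHt, vHyp_eq hH]
  split_ifs with h0
  · rw [h0]
    rfl
  · rw [vec, height, add_sub_cancel_left, dotProduct_smul, smul_eq_mul, inv_mul_eq_one₀ h0, eq_comm]

theorem isTargetedTilting_iff {H Ht : Hyperplane n} (hH : T.StrictlyInside H)
    (hHt : T.StrictlyInside Ht) {R' : Set (Fin n)} : T.IsTargetedTilting H R' Ht ↔
      (∀ k ∈ T.cutRays H \ R', T.gauge Ht ⬝ᵥ (T.vBd k).vec T.xbar = (T.vBd k).height) ∧
      ∀ k ∉ T.cutRays H \ R', T.gauge Ht ⬝ᵥ T.ray k = T.gauge H ⬝ᵥ T.ray k := by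
  constructor
  · intro h
    exact ⟨fun k hk => (on_iff hHt _).mp (h.tilted k hk),
      fun k hk => (vHyp_on_iff hH hHt k).mp (h.kept k hk)⟩
  · intro h
    exact ⟨hHt.le, fun k hk => (on_iff hHt _).mpr (h.1 k hk),
      fun k hk => (vHyp_on_iff hH hHt k).mpr (h.2 k hk)⟩

theorem exists_isTargetedTilting {H : Hyperplane n} (hH : T.StrictlyInside H) {R' : Set (Fin n)}
    (hsub : R' ⊆ T.cutRays H) (hne : R'.Nonempty) : ∃ Ht, T.IsTargetedTilting H R' Ht := by
  classical
  choose c hc hv using T.exists_vec_vBd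
  obtain ⟨γ, hγ⟩ := T.exists_dotProduct_ray fun k =>
    if k ∈ T.cutRays H \ R' then (T.vBd k).height / c k else T.gauge H ⬝ᵥ T.ray k
  obtain ⟨j, hj⟩ := hne
  -- Nonemptiness of R' matters here: on a ray of R' the prescribed value is the positive gauge of
  -- H.
  have hγ0 : -γ ≠ 0 := by
    intro h0
    have h1 := hγ j
    rw [if_neg fun h => h.2 hj, neg_eq_zero.mp h0, zero_dotProduct] at h1
    exact ((mem_cutRays_iff hH j).mp (hsub hj)).1.ne h1
  -- The slack of `xbar` is normalized to 1, so the gauge is γ itself.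
  let Ht : Hyperplane n := ⟨-γ, -γ ⬝ᵥ T.xbar - 1, hγ0⟩
  have hHt : T.StrictlyInside Ht := sub_one_lt _
  have hgauge : T.gauge Ht = γ := by
    simp [gauge, Ht]
  refine ⟨Ht, (isTargetedTilting_iff hH hHt).mpr ⟨fun k hk => ?_, fun k hk => ?_⟩⟩
  · rw [hgauge, hv, dotProduct_smul, hγ, if_pos hk, smul_eq_mul, mul_div_cancel₀ _ (hc k).ne']
  · rw [hgauge, hγ, if_neg hk]

theorem IsTargetedTilting.carrier_eq {H Ht Ht' : Hyperplane n} (hH : T.StrictlyInside H)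
    {R' : Set (Fin n)} (h : T.IsTargetedTilting H R' Ht) (h' : T.IsTargetedTilting H R' Ht') :
    Ht'.carrier = Ht.carrier := by
  have hs := h.strictlyInside hH
  have hs' := h'.strictlyInside hH
  rw [isTargetedTilting_iff hH hs] at h
  rw [isTargetedTilting_iff hH hs'] at h'
  have hgauge : T.gauge Ht' = T.gauge Ht := by
    refine T.eq_of_dotProduct_ray fun k => ?_
    by_cases hk : k ∈ T.cutRays H \ R'
    · obtain ⟨c, hc, hv⟩ := T.exists_vec_vBd k
      have := (h'.1 k hk).trans (h.1 k hk).symm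
      rw [hv, dotProduct_smul, dotProduct_smul, smul_eq_mul, smul_eq_mul] at this
      exact mul_left_cancel₀ hc.ne' this
    · exact (h'.2 k hk).trans (h.2 k hk).symm
  ext x
  rw [mem_carrier_iff hs, mem_carrier_iff hs', hgauge]

/-- On a spared ray the exit violates H but lies on the tilted hyperplane, so tilting lowers the
gauge; elsewhere it is unchanged. -/
theorem IsTargetedTilting.gauge_ray_le {H Ht : Hyperplane n} (hH : T.StrictlyInside H)
    {R' : Set (Fin n)} (h : T.IsTargetedTilting H R' Ht) (k : Fin n) :
    T.gauge Ht ⬝ᵥ T.ray k ≤ T.gauge H ⬝ᵥ T.ray k := by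
  have hs := h.strictlyInside hH
  rw [isTargetedTilting_iff hH hs] at h
  by_cases hk : k ∈ T.cutRays H \ R'
  · obtain ⟨c, hc, hv⟩ := T.exists_vec_vBd k
    have h1 := (mem_cutRays_iff_violates hH k).mp hk.1
    rw [← h.1 k hk, hv, dotProduct_smul, dotProduct_smul, smul_eq_mul, smul_eq_mul] at h1
    exact (lt_of_mul_lt_mul_left h1 hc.le).le
  · exact (h.2 k hk).le

theorem IsTargetedTilting.cutRays_eq {H Ht : Hyperplane n} (hH : T.StrictlyInside H)
    {R' : Set (Fin n)} (hsub : R' ⊆ T.cutRays H) (h : T.IsTargetedTilting H R' Ht) :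
    T.cutRays Ht = R' := by
  have hs := h.strictlyInside hH
  rw [isTargetedTilting_iff hH hs] at h
  ext k
  rw [mem_cutRays_iff_violates hs]
  by_cases hk : k ∈ T.cutRays H \ R'
  · rw [h.1 k hk]
    exact ⟨fun h => absurd h (lt_irrefl _), fun h => absurd h hk.2⟩
  · have h1 : T.gauge Ht ⬝ᵥ (T.vBd k).vec T.xbar = T.gauge H ⬝ᵥ (T.vBd k).vec T.xbar := by
      obtain ⟨c, hc, hv⟩ := T.exists_vec_vBd k
      rw [hv, dotProduct_smul, dotProduct_smul, h.2 k hk]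
    rw [h1, ← mem_cutRays_iff_violates hH]
    exact ⟨fun h2 => by_contra fun h3 => hk ⟨h2, h3⟩, fun h => hsub h⟩

/-- `H` and its targeted tilting remove the same edges. -/
theorem IsTargetedTilting.removes_iff {H Ht : Hyperplane n} (hH : T.StrictlyInside H)
    {R' : Set (Fin n)} (hsub : R' ⊆ T.cutRays H) (h : T.IsTargetedTilting H R' Ht) {e : Edge n}
    (he : T.Created e) {j : Fin n} (hj : j ∈ R') :
    T.Removes H R' j e ↔ T.Removes Ht Set.univ j e := by
  have hs := h.strictlyInside hH
  have hcutt := h.cutRays_eq hH hsub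
  constructor
  · rintro ⟨hviol, horig, hlies⟩
    refine ⟨?_, horig, by simp⟩
    by_contra hnot
    rw [violates_iff hs, not_lt] at hnot
    rw [violates_iff hH] at hviol
    obtain ⟨k, c, d, hc, hd, hvec⟩ := he.vec_of_originatesFrom horig
    have hj' : j ∈ T.cutRays Ht := hcutt ▸ hj
    obtain ⟨φ, hφ, heq⟩ := T.exists_bounds_vec_exit_eq e.dir he.start_mem
    change φ ⬝ᵥ (T.element e).vec T.xbar = (T.element e).height at heq
    have hjlt := hφ.ray_lt_gauge hs hj'
    -- Were `k` not spared, both gauges would agree on the element.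
    have hk : k ∈ T.cutRays H \ R' := by
      by_contra hk
      have h1 := ((isTargetedTilting_iff hH hs).mp h).2 k hk
      have h2 := ((isTargetedTilting_iff hH hs).mp h).2 j fun h => h.2 hj
      rw [hvec] at hnot hviol
      simp only [dotProduct_add, dotProduct_smul, h1, h2] at hnot hviol
      exact absurd hviol (not_lt.mpr hnot)
    have hkle : φ ⬝ᵥ T.ray k ≤ T.gauge Ht ⬝ᵥ T.ray k := by
      obtain ⟨c, hc, hv⟩ := T.exists_vec_vBd k
      have h1 : φ ⬝ᵥ (T.vBd k).vec T.xbar ≤ (T.vBd k).height :=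
        hφ.vec_exit_le (T.ray k) T.xbar_mem_interior
      rw [← ((isTargetedTilting_iff hH hs).mp h).1 k hk, hv, dotProduct_smul, dotProduct_smul,
        smul_eq_mul, smul_eq_mul] at h1
      exact le_of_mul_le_mul_left h1 hc
    -- If c = 0, the element lies on a protected ray. If c > 0, the strict inequality on ray `j`
    -- makes the tilted gauge exceed φ, which equals the height.
    rcases hc.eq_or_lt with rfl | hc
    · rw [zero_smul, zero_add] at hvec
      exact hlies ⟨k, hk.2, liesOnRay_of_vec hd hvec⟩
    · rw [← heq, hvec] at hnot
      simp only [dotProduct_add, dotProduct_smul, smul_eq_mul] at hnot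
      have h1 := mul_lt_mul_of_pos_left hjlt hc
      have h2 := mul_le_mul_of_nonneg_left hkle hd.le
      linarith
  · rintro ⟨hviol, horig, -⟩
    refine ⟨?_, horig, ?_⟩
    · rw [violates_iff hs] at hviol
      rw [violates_iff hH]
      refine hviol.trans_le ?_
      obtain ⟨i, k, c, d, hc, hd, hvec⟩ := he.vec_nonneg
      rw [hvec]
      simp only [dotProduct_add, dotProduct_smul, smul_eq_mul]
      exact add_le_add (mul_le_mul_of_nonneg_left (h.gauge_ray_le hH i) hc)
        (mul_le_mul_of_nonneg_left (h.gauge_ray_le hH k) hd.le)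
    · rintro ⟨k, hk, hlies⟩
      exact hk (hcutt ▸ he.mem_cutRays_of_liesOnRay hs hlies hviol)

/-- An edge along the tilted hyperplane towards a spared ray leads to the element of that ray. -/
theorem IsTargetedTilting.element_newEdge {H Ht : Hyperplane n} (hH : T.StrictlyInside H)
    {R' : Set (Fin n)} (hsub : R' ⊆ T.cutRays H) (h : T.IsTargetedTilting H R' Ht) {j k : Fin n}
    (hj : j ∈ R') (hk : k ∈ T.cutRays H \ R') :
    T.element (T.newEdge Ht j k) = T.element ⟨T.xbar, T.ray k⟩ := by
  have hs := h.strictlyInside hH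
  have hj' : j ∈ T.cutRays Ht := h.cutRays_eq hH hsub ▸ hj
  have hstart : (T.newEdge Ht j k).start ∈ interior T.S := ((mem_cutRays_iff hs j).mp hj').2
  have hval := ((isTargetedTilting_iff hH hs).mp h).1 k hk
  change T.exit _ _ = T.exit T.xbar (T.ray k)
  rw [vBd] at hval
  rcases T.exit_cases (T.ray k) T.xbar_mem_interior with ⟨he, hr⟩ | ⟨t, ht, he, hf, -⟩ <;>
    rw [he] at hval ⊢
  · have hdir : (T.newEdge Ht j k).dir = T.ray k := by
      have h0 : T.gauge Ht ⬝ᵥ T.ray k = 0 := hval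
      rw [newEdge_dir hs, h0, zero_div, zero_smul, sub_zero]
    rw [hdir]
    exact T.exit_eq_ray (recession_of_recession hr hstart)
  · have hpt : (T.newEdge Ht j k).start + t • (T.newEdge Ht j k).dir = T.xbar + t • T.ray k := by
      rw [vec, height, add_sub_cancel_left, dotProduct_smul, smul_eq_mul] at hval
      rw [newEdge_point hs, hval, sub_self, zero_div, zero_smul, zero_add]
    rw [T.exit_eq_point hstart ht.le (hpt ▸ hf), hpt]

theorem IsTargetedTilting.newEdge_eq {H Ht : Hyperplane n} (hH : T.StrictlyInside H)
    {R' : Set (Fin n)} (h : T.IsTargetedTilting H R' Ht) {j k : Fin n}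
    (hj : j ∉ T.cutRays H \ R') (hk : k ∉ T.cutRays H \ R') :
    T.newEdge Ht j k = T.newEdge H j k := by
  have hs := h.strictlyInside hH
  have hkept := ((isTargetedTilting_iff hH hs).mp h).2
  have hdir : (T.newEdge Ht j k).dir = (T.newEdge H j k).dir := by
    rw [newEdge_dir hs, newEdge_dir hH, hkept j hj, hkept k hk]
  have hstart : T.vertex Ht j = T.vertex H j := by
    rw [vertex_eq, vertex_eq, hkept j hj]
  exact congrArg₂ Edge.mk hstart hdir

theorem IsTargetedTilting.exists_element_iff {H Ht : Hyperplane n} (hH : T.StrictlyInside H)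
    {D : Set (Edge n)} {Rc : Set (Fin n)} (hrun : T.Run D Rc)
    {R' : Set (Fin n)} (hsub : R' ⊆ T.cutRays H) (hcut : Rc ∩ T.cutRays H ⊆ R')
    (h : T.IsTargetedTilting H R' Ht) (q : PointOrRay n) :
    (∃ e ∈ T.PHA1 H R' D, T.element e = q) ↔ ∃ e ∈ T.PHA1 Ht Set.univ D, T.element e = q := by
  have hs := h.strictlyInside hH
  have hcutt := h.cutRays_eq hH hsub
  have hR : R' ∩ T.cutRays H = R' := Set.inter_eq_left.mpr hsub
  have hD := hrun.created
  have hmem := fun e => mem_PHA1_iff hH (RA := R') (D := D) (e := e)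
  have hmemt := fun e => mem_PHA1_iff hs (RA := Set.univ) (D := D) (e := e)
  rw [hR] at hmem
  rw [Set.univ_inter, hcutt] at hmemt
  have hR_not : ∀ j ∈ R', j ∉ T.cutRays H \ R' := fun j hj h => h.2 hj
  constructor
  · rintro ⟨e, he, rfl⟩
    refine ⟨e, (hmemt e).mpr ?_, rfl⟩
    rcases (hmem e).mp he with ⟨heD, hrem⟩ | ⟨j, hj, k, hk, rfl⟩
    · exact Or.inl ⟨heD, fun j hj hr =>
        hrem j hj ((h.removes_iff hH hsub (hD e heD) hj).mpr hr)⟩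
    · exact Or.inr ⟨j, hj, k, fun h => hk (hsub h),
        (h.newEdge_eq hH (hR_not j hj) fun h => hk h.1).symm⟩
  · rintro ⟨e, he, rfl⟩
    rcases (hmemt e).mp he with ⟨heD, hrem⟩ | ⟨j, hj, k, hk, rfl⟩
    · exact ⟨e, (hmem e).mpr (Or.inl ⟨heD, fun j hj hr =>
        hrem j hj ((h.removes_iff hH hsub (hD e heD) hj).mp hr)⟩), rfl⟩
    · by_cases hkH : k ∈ T.cutRays H
      · rw [h.element_newEdge hH hsub hj ⟨hkH, hk⟩]
        refine ⟨_, (hmem _).mpr (Or.inl ⟨hrun.initial_mem k fun h => hk (hcut ⟨h, hkH⟩),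
          fun i _ hrem => ?_⟩), rfl⟩
        obtain ⟨c, hc, hv⟩ := T.exists_vec_vBd k
        exact hrem.2.2 ⟨k, hk, liesOnRay_of_vec hc hv⟩
      · exact ⟨_, (hmem _).mpr (Or.inr ⟨j, hj, k, hkH,
          h.newEdge_eq hH (hR_not j hj) fun h => hkH h.1⟩), rfl⟩

end Data

end GIC

theorem mainTheorem2 {n : ℕ} (T : GIC.Data n) (H : GIC.Hyperplane n)
    (hvalid : T.P ⊆ H.pos) (hnondeg : T.xbar ∉ H.carrier)
    (D : Set (GIC.Edge n)) (Rc : Set (Fin n)) (hrun : T.Run D Rc)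
    (hproper : T.Proper (T.points D) (T.rays D))
    (R' : Set (Fin n)) (hsub : R' ⊆ T.cutRays H) (hcut : Rc ∩ T.cutRays H ⊆ R') :
    T.Proper (T.points (T.PHA1 H R' D)) (T.rays (T.PHA1 H R' D)) ∧
    (R'.Nonempty → ∃ Ht : GIC.Hyperplane n, T.IsTargetedTilting H R' Ht ∧
      ∀ Ht' : GIC.Hyperplane n, T.IsTargetedTilting H R' Ht' → Ht'.carrier = Ht.carrier) ∧
    (∀ Ht : GIC.Hyperplane n, T.IsTargetedTilting H R' Ht →
      T.points (T.PHA1 H R' D) = T.points (T.PHA1 Ht Set.univ D) ∧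
      T.rays (T.PHA1 H R' D) = T.rays (T.PHA1 Ht Set.univ D)) := by
  have hH := GIC.Data.strictlyInside_of_valid hvalid hnondeg
  refine ⟨GIC.Data.proper_PHA1 hvalid hnondeg hrun hproper hsub hcut, fun hne => ?_,
    fun Ht h => ⟨?_, ?_⟩⟩
  · obtain ⟨Ht, h⟩ := GIC.Data.exists_isTargetedTilting hH hsub hne
    exact ⟨Ht, h, fun Ht' h' => h.carrier_eq hH h'⟩
  · exact Set.ext fun p => h.exists_element_iff hH hrun hsub hcut (.point p)
  · exact Set.ext fun d => h.exists_element_iff hH hrun hsub hcut (.ray d)
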